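/- Let $X$ be a locally compact Hausdorff space that is not compact. A kernel on $X$ is a real positive definite function $k:X\times X\to\mathbb R$ with reproducing kernel Hilbert space $H_k$. For a finite signed regular Borel measure $\mu$ on $X$ and a bounded continuous kernel $k$ put $f_\mu=\int_X k(\cdot,x)\,d\mu(x)\in H_k$ (Bochner integral) and $d_k(\mu,\nu)=\|f_\mu-f_\nu\|_{H_k}$ (the maximum mean discrepancy). Call $k$ *ISPD* if $d_k$ separates the finite signed regular Borel measures, i.e. $d_k(\mu,\nu)=0$ implies $\mu=\nu$; *characteristic* if $\mu\mapsto f_\mu$ is injective on regular Borel probability measures; and say that $k$ *metrizes weak convergence* if for all regular Borel probability measures $P_n,P$ one has $d_k(P_n,P)\to 0$ if and only if $\int f\,dP_n\to\int f\,dP$ for every bounded continuous $f$. Let $C_b$ be the bounded continuous real functions on $X$ and $C_0\subset C_b$ those vanishing at infinity. (i) Suppose that $X$ is metrizable (for instance an open subset of $\mathbb R^d$) or, more generally, that some bounded continuous ISPD kernel exists on $X$. Then there is a bounded continuous kernel $k$ on $X$, with $H_k\subset C_b$, that is ISPD (hence characteristic) but does not metrize weak convergence. In particular, on such a space the following two claims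 are both false: "every kernel $k$ with $H_k\subset C_b$ metrizes weak convergence if and only if it is continuous and ISPD" (so the condition $H_k\subset C_0$, under which the equivalence is known, cannot be replaced by $H_k\subset C_b$), and "every bounded continuous kernel metrizes weak convergence if and only if it is characteristic" (which the earlier Theorem 12 of Simon-Gabriel and Schölkopf would give). (ii) Suppose that $X$ is metrizable or that some bounded continuous ISPD kernel $k_0$ with $H_{k_0}\subset C_0$ exists on $X$. Then there is a bounded continuous kernel $k$ on $X$, with $H_k\subset C_b$, that is characteristic and not ISPD, but metrizes weak convergence. -/

import Mathlib

open MeasureTheory Filter Topology Set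
open scoped BoundedContinuousFunction ZeroAtInfty

/-- A real-valued reproducing kernel on `X`, that is a (symmetric) positive definite function. -/
structure PDKernel (X : Type*) where
  toFun : X → X → ℝ
  posSemidef : (Matrix.of toFun).PosSemidef

namespace PDKernel

variable {X : Type*}

instance : CoeFun (PDKernel X) (fun _ => X → X → ℝ) := ⟨PDKernel.toFun⟩

/-- The kernel as a matrix of operators on the one-dimensional space `ℝ`
(multiplication by `k x y`), the form in which Mathlib's theory of RKHSs uses it. -/
noncomputable def opMatrix (k : PDKernel X) : Matrix X X (ℝ →L[ℝ] ℝ) :=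
  Matrix.of fun x y => k x y • ContinuousLinearMap.id ℝ ℝ

theorem posSemidef_opMatrix (k : PDKernel X) : k.opMatrix.PosSemidef := by
  refine (RKHS.posSemidef_tfae (K := k.opMatrix).out 0 2).mpr ?_
  refine ⟨?_, fun v => ?_⟩
  · ext x y
    have h := k.posSemidef.isHermitian.apply x y
    simp only [Matrix.of_apply, star_trivial] at h
    simp [opMatrix, h, Matrix.conjTranspose_apply, ContinuousLinearMap.star_eq_adjoint,
      ContinuousLinearMap.adjoint_id]
  · have h := k.posSemidef.2 v
    simp only [Finsupp.sum, Matrix.of_apply, star_trivial] at h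
    simp only [Finsupp.sum, opMatrix, Matrix.of_apply, map_sum]
    rw [Finset.sum_comm]
    refine h.trans_eq ?_
    refine Finset.sum_congr rfl fun x _ => Finset.sum_congr rfl fun y _ => ?_
    simp
    ring

instance (k : PDKernel X) : Fact k.opMatrix.PosSemidef := ⟨k.posSemidef_opMatrix⟩

/-- The reproducing kernel Hilbert space `H_k` of `k`. -/
abbrev Hilb (k : PDKernel X) : Type _ := RKHS.OfKernel k.opMatrix

/-- The kernel function `k(·, x)`, as an element of `H_k`. -/
noncomputable def feature (k : PDKernel X) (x : X) : k.Hilb :=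
  RKHS.kerFun k.Hilb x (1 : ℝ)

theorem feature_apply (k : PDKernel X) (x y : X) : k.feature x y = k y x := by
  rw [feature, RKHS.kerFun_apply, RKHS.OfKernel.kernel_ofKernel]
  simp [opMatrix]

theorem inner_feature (k : PDKernel X) (f : k.Hilb) (x : X) :
    inner ℝ (k.feature x) f = f x := by
  simp [feature]

theorem inner_feature_feature (k : PDKernel X) (x y : X) :
    inner ℝ (k.feature x) (k.feature y) = k x y := by
  rw [inner_feature, feature_apply]

/-- `sup_{x,y} |k x y| < ∞`. -/
def IsBounded (k : PDKernel X) : Prop := ∃ C : ℝ, ∀ x y, |k x y| ≤ C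

/-- Joint continuity of the kernel. -/
def IsContinuous [TopologicalSpace X] (k : PDKernel X) : Prop :=
  Continuous fun p : X × X => k p.1 p.2

/-- `H_k ⊂ C_b`: every function of the RKHS is bounded and continuous. -/
def HilbSubsetCb [TopologicalSpace X] (k : PDKernel X) : Prop :=
  ∀ f : k.Hilb, ∃ g : X →ᵇ ℝ, ∀ x, g x = f x

/-- `H_k ⊂ C_0`: every function of the RKHS is continuous and vanishes at infinity. -/
def HilbSubsetC0 [TopologicalSpace X] (k : PDKernel X) : Prop :=
  ∀ f : k.Hilb, ∃ g : C₀(X, ℝ), ∀ x, g x = f x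

section Measure

variable [MeasurableSpace X]

/-- The kernel mean embedding `f_μ = ∫ k(·, x) dμ(x)` of a finite signed measure, as a Bochner
integral with values in `H_k`. -/
noncomputable def kme (k : PDKernel X) (μ : SignedMeasure X) : k.Hilb :=
  ∫ᵛ x, k.feature x ∂<•μ

theorem kme_toSignedMeasure (k : PDKernel X) (μ : Measure X) [IsFiniteMeasure μ] :
    k.kme μ.toSignedMeasure = ∫ x, k.feature x ∂μ :=
  VectorMeasure.integral_toSignedMeasure

/-- The maximum mean discrepancy `d_k(μ, ν) = ‖f_μ - f_ν‖`. -/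
noncomputable def mmd (k : PDKernel X) (μ ν : SignedMeasure X) : ℝ := ‖k.kme μ - k.kme ν‖

end Measure

end PDKernel

section Measures

variable (X : Type*) [TopologicalSpace X] [MeasurableSpace X]

/-- The finite signed regular Borel measures on `X` (regularity of `μ` is that of `|μ|`). -/
def regularSignedMeasures : Set (SignedMeasure X) := {μ | μ.variation.Regular}

/-- The regular Borel probability measures on `X`. -/
def regularProbabilityMeasures : Set (ProbabilityMeasure X) := {P | (P : Measure X).Regular}

variable {X}

/-- A probability measure, regarded as a signed measure. -/
noncomputable def probToSigned (P : ProbabilityMeasure X) : SignedMeasure X :=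
  (P : Measure X).toSignedMeasure

end Measures

namespace PDKernel

variable {X : Type*} [TopologicalSpace X] [MeasurableSpace X]

/-- `k` is characteristic to a set `D` of signed measures if the kernel mean embedding is
injective on `D`. -/
def CharacteristicTo (k : PDKernel X) (D : Set (SignedMeasure X)) : Prop :=
  InjOn k.kme D

/-- `k` is integrally strictly positive definite to a set `D` of signed measures if its MMD
separates the elements of `D`. -/
def ISPDTo (k : PDKernel X) (D : Set (SignedMeasure X)) : Prop :=
  ∀ μ ∈ D, ∀ ν ∈ D, k.mmd μ ν = 0 → μ = ν

/-- Characteristic (to the set of regular probability measures). -/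
def IsCharacteristic (k : PDKernel X) : Prop :=
  k.CharacteristicTo (probToSigned '' regularProbabilityMeasures X)

/-- Integrally strictly positive definite (to all finite signed regular Borel measures). -/
def IsISPD (k : PDKernel X) : Prop := k.ISPDTo (regularSignedMeasures X)

/-- `k` metrizes the weak convergence of probability measures: for sequences of (regular)
probability measures, convergence in MMD is equivalent to weak convergence. The topology of
Mathlib's `ProbabilityMeasure X` is that of weak convergence, i.e. of the convergence of the
integrals of all bounded continuous functions. -/
def MetrizesWeakConvergence [OpensMeasurableSpace X] (k : PDKernel X) : Prop :=
  ∀ (P : ℕ → ProbabilityMeasure X) (Q : ProbabilityMeasure X),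
    (∀ n, P n ∈ regularProbabilityMeasures X) → Q ∈ regularProbabilityMeasures X →
      (Tendsto (fun n => k.mmd (probToSigned (P n)) (probToSigned Q)) atTop (𝓝 0) ↔
        Tendsto P atTop (𝓝 Q))

end PDKernel

/-! The metrizable case carries both halves. Partitions of unity subordinate to balls of radius
1/(n+1), used as coordinates in an ℓ² space, give a bounded continuous feature map Φ whose functions
⟪v, Φ ·⟫ approximate every compactly supported continuous function uniformly
(`exists_continuous_approximatesCompactlySupported`). Convergence of ∫ Φ therefore forces vague
convergence. Between regular probability measures this is weak convergence, since no mass can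
escape, and weak convergence conversely gives norm convergence of ∫ Φ.

For (i), take the kernel 1 + w(x)w(y)⟪Φ x, Φ y⟫, where w vanishes only at a point p and tends to 0
along a sequence u without cluster points. The summand 1 records the total mass and the weighted
part determines the measure off p, so together they determine the measure. Yet the Diracs at u n
tend to the Dirac at p in MMD, and not weakly.

For (ii), replace Φ by Φ - Φ p. Distances between probability measures do not change, because the
translation cancels for equal masses, but the Dirac at p now has the same embedding as the zero
measure.

Without metrizability, the feature map of the given kernel is used as an embedding into a Hilbert
space. If an ISPD kernel metrizes weak convergence, testing on Diracs shows that X is metrizable; if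
it does not, it is itself the example for (i). If H_k ⊂ C_0, then X is metrizable outright. -/

/-! ### Measures carried by countably many compact sets. -/

section CompactCarrier

/-- `μ` is concentrated on a countable union of compact sets. -/
def HasSigmaCompactCarrier {X : Type*} [TopologicalSpace X] [MeasurableSpace X]
    (μ : Measure X) : Prop :=
  ∃ K : ℕ → Set X, (∀ n, IsCompact (K n)) ∧ ∀ᵐ x ∂μ, x ∈ ⋃ n, K n

variable {X : Type*} [TopologicalSpace X] [MeasurableSpace X]

theorem HasSigmaCompactCarrier.mono_ac {μ ν : Measure X} (hμ : HasSigmaCompactCarrier μ)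
    (h : ν ≪ μ) : HasSigmaCompactCarrier ν := by
  obtain ⟨K, hK, hμK⟩ := hμ
  exact ⟨K, hK, h.ae_le hμK⟩

theorem HasSigmaCompactCarrier.add {μ ν : Measure X} (hμ : HasSigmaCompactCarrier μ)
    (hν : HasSigmaCompactCarrier ν) : HasSigmaCompactCarrier (μ + ν) := by
  obtain ⟨K, hK, hμK⟩ := hμ
  obtain ⟨L, hL, hνL⟩ := hν
  refine ⟨fun n => K n ∪ L n, fun n => (hK n).union (hL n), ?_⟩
  rw [ae_add_measure_iff, iUnion_union_distrib]
  exact ⟨hμK.mono fun x hx => Or.inl hx, hνL.mono fun x hx => Or.inr hx⟩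

variable [BorelSpace X]

/-- Continuous functions into a metrizable space are almost everywhere strongly measurable for
measures carried by a countable union of compact sets. -/
theorem HasSigmaCompactCarrier.aestronglyMeasurable {E : Type*} [TopologicalSpace E]
    [TopologicalSpace.PseudoMetrizableSpace E] {μ : Measure X} (hμ : HasSigmaCompactCarrier μ)
    {f : X → E} (hf : Continuous f) : AEStronglyMeasurable f μ := by
  obtain ⟨K, hK, hμK⟩ := hμ
  borelize E
  rw [aestronglyMeasurable_iff_aemeasurable_separable]
  refine ⟨hf.measurable.aemeasurable, ⋃ n, f '' K n,
    TopologicalSpace.IsSeparable.iUnion fun n => ((hK n).image hf).isSeparable, ?_⟩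
  filter_upwards [hμK] with x hx
  obtain ⟨n, hn⟩ := mem_iUnion.1 hx
  exact mem_iUnion.2 ⟨n, mem_image_of_mem f hn⟩

theorem HasSigmaCompactCarrier.integrable {E : Type*} [NormedAddCommGroup E]
    {μ : Measure X} [IsFiniteMeasure μ] (hμ : HasSigmaCompactCarrier μ)
    {f : X → E} (hf : Continuous f) {C : ℝ} (hC : ∀ x, ‖f x‖ ≤ C) : Integrable f μ :=
  Integrable.of_bound (hμ.aestronglyMeasurable hf) C (Eventually.of_forall hC)

variable [T2Space X]

/-- Inner regularity exhausts the mass by compact sets. This is what makes Bochner integrals of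
continuous feature maps meaningful when neither X nor the Hilbert space is separable. -/
theorem MeasureTheory.Measure.Regular.hasSigmaCompactCarrier {μ : Measure X} [IsFiniteMeasure μ]
    (hμ : μ.Regular) : HasSigmaCompactCarrier μ := by
  have h (n : ℕ) : ∃ K ⊆ (univ : Set X), IsCompact K ∧ μ (univ \ K) < ((n : ENNReal) + 1)⁻¹ :=
    MeasurableSet.univ.exists_isCompact_sdiff_lt (measure_ne_top μ _)
      (ENNReal.inv_ne_zero.2 (by finiteness))
  choose K _ hK hμK using h
  refine ⟨K, hK, ?_⟩
  rw [ae_iff]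
  have hlim : Tendsto (fun n : ℕ => ((n : ENNReal) + 1)⁻¹) atTop (𝓝 0) :=
    (ENNReal.tendsto_inv_nat_nhds_zero.comp (tendsto_add_atTop_nat 1)).congr fun n => by simp
  refine le_antisymm (ge_of_tendsto' hlim fun n => ?_) bot_le
  have hsub : {x | x ∉ ⋃ n, K n} ⊆ univ \ K n := fun x hx =>
    ⟨mem_univ x, fun hxK => hx (mem_iUnion.2 ⟨n, hxK⟩)⟩
  exact (measure_mono hsub).trans (hμK n).le

theorem regular_dirac (x : X) : (Measure.dirac x).Regular := by
  have : (Measure.dirac x).InnerRegular := by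
    constructor
    intro U hU r hr
    rw [Measure.dirac_apply' x hU] at hr
    by_cases hx : x ∈ U
    · refine ⟨{x}, singleton_subset_iff.2 hx, isCompact_singleton, ?_⟩
      simpa [hx] using hr
    · simp [hx] at hr
  infer_instance

end CompactCarrier

/-! ### Mean embeddings depend only on the kernel. -/

section Embedding

variable {X : Type*} [MeasurableSpace X]
variable {H : Type*} [NormedAddCommGroup H] [InnerProductSpace ℝ H] [CompleteSpace H]
variable {H' : Type*} [NormedAddCommGroup H'] [InnerProductSpace ℝ H'] [CompleteSpace H']

theorem inner_integral_integral {μ ν : Measure X} {f g : X → H} (hf : Integrable f μ)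
    (hg : Integrable g ν) :
    inner ℝ (∫ x, f x ∂μ) (∫ y, g y ∂ν) = ∫ y, ∫ x, inner ℝ (f x) (g y) ∂μ ∂ν := by
  rw [← integral_inner hg]
  refine integral_congr_ae (Eventually.of_forall fun y => ?_)
  simp only
  rw [real_inner_comm, ← integral_inner hf]
  simp only [real_inner_comm]

/-- The distance between the mean embeddings depends on the feature map only through the
kernel. -/
theorem norm_integral_sub_integral_eq_of_inner_eq {μ ν : Measure X} {f : X → H} {g : X → H'}
    (h : ∀ x y, (inner ℝ (f x) (f y) : ℝ) = inner ℝ (g x) (g y))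
    (hfμ : Integrable f μ) (hfν : Integrable f ν) (hgμ : Integrable g μ) (hgν : Integrable g ν) :
    ‖∫ x, f x ∂μ - ∫ x, f x ∂ν‖ = ‖∫ x, g x ∂μ - ∫ x, g x ∂ν‖ := by
  rw [← sq_eq_sq₀ (norm_nonneg _) (norm_nonneg _), norm_sub_sq_real, norm_sub_sq_real]
  simp only [← real_inner_self_eq_norm_sq, inner_integral_integral hfμ hfμ,
    inner_integral_integral hfν hfν, inner_integral_integral hfμ hfν,
    inner_integral_integral hgμ hgμ, inner_integral_integral hgν hgν,
    inner_integral_integral hgμ hgν, h]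

end Embedding

/-! ### Kernels, feature maps and MMD. -/

namespace PDKernel

section Feature

variable {X : Type*} (k : PDKernel X)

theorem norm_feature_sub_sq (x y : X) :
    ‖k.feature x - k.feature y‖ ^ 2 = k x x - 2 * k x y + k y y := by
  rw [norm_sub_sq_real, ← real_inner_self_eq_norm_sq, ← real_inner_self_eq_norm_sq,
    inner_feature_feature, inner_feature_feature, inner_feature_feature]

variable {k}

theorem IsBounded.exists_norm_feature_le (hk : k.IsBounded) : ∃ C, ∀ x, ‖k.feature x‖ ≤ C := by
  obtain ⟨C, hC⟩ := hk
  refine ⟨Real.sqrt C, fun x => Real.le_sqrt_of_sq_le ?_⟩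
  rw [← real_inner_self_eq_norm_sq, inner_feature_feature]
  exact (le_abs_self _).trans (hC x x)

theorem IsContinuous.continuous_feature [TopologicalSpace X] (hk : k.IsContinuous) :
    Continuous k.feature := by
  refine continuous_iff_continuousAt.2 fun x => ?_
  rw [ContinuousAt, tendsto_iff_norm_sub_tendsto_zero]
  have h1 : Continuous fun y => k y y - 2 * k y x + k x x := by
    have e1 : Continuous fun y => k y y := hk.comp (continuous_id.prodMk continuous_id)
    have e2 : Continuous fun y => k y x := hk.comp (continuous_id.prodMk continuous_const)
    fun_prop
  have h2 : Continuous fun y => ‖k.feature y - k.feature x‖ := by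
    refine h1.sqrt.congr fun y => ?_
    rw [← norm_feature_sub_sq, Real.sqrt_sq (norm_nonneg _)]
  simpa using h2.tendsto x

/-- By the reproducing property f is x ↦ ⟪k(·, x), f⟫; continuity is that of the feature map, and
the bound is Cauchy–Schwarz. -/
theorem hilbSubsetCb_of_isBounded_of_isContinuous [TopologicalSpace X] (hb : k.IsBounded)
    (hc : k.IsContinuous) : k.HilbSubsetCb := by
  intro f
  obtain ⟨C, hC⟩ := hb.exists_norm_feature_le
  refine ⟨BoundedContinuousFunction.ofNormedAddCommGroup (fun x => inner ℝ (k.feature x) f)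
    (hc.continuous_feature.inner continuous_const) (C * ‖f‖) fun x => ?_,
    fun x => k.inner_feature f x⟩
  exact (norm_inner_le_norm _ _).trans (mul_le_mul_of_nonneg_right (hC x) (norm_nonneg _))

end Feature

section OfFeature

variable {X : Type*} {H : Type*} [NormedAddCommGroup H] [InnerProductSpace ℝ H]

/-- The kernel with a given feature map. -/
noncomputable def ofFeature (Φ : X → H) : PDKernel X where
  toFun x y := inner ℝ (Φ x) (Φ y)
  posSemidef := by
    refine ⟨?_, fun v => ?_⟩
    · ext x y
      simp [Matrix.conjTranspose_apply, real_inner_comm]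
    · have h : (0 : ℝ) ≤ inner ℝ (v.sum fun x a => a • Φ x) (v.sum fun x a => a • Φ x) :=
        real_inner_self_nonneg
      refine h.trans_eq ?_
      simp only [Finsupp.sum, sum_inner, inner_sum, real_inner_smul_left, real_inner_smul_right,
        Matrix.of_apply, star_trivial]
      refine Finset.sum_congr rfl fun x _ => Finset.sum_congr rfl fun y _ => ?_
      rw [real_inner_comm]
      ring

@[simp]
theorem ofFeature_apply (Φ : X → H) (x y : X) : ofFeature Φ x y = inner ℝ (Φ x) (Φ y) := rfl

theorem isBounded_ofFeature {Φ : X → H} {C : ℝ} (hC : ∀ x, ‖Φ x‖ ≤ C) :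
    (ofFeature Φ).IsBounded :=
  ⟨C * C, fun x y => (abs_real_inner_le_norm _ _).trans
    (mul_le_mul (hC x) (hC y) (norm_nonneg _) ((norm_nonneg _).trans (hC x)))⟩

theorem isContinuous_ofFeature [TopologicalSpace X] {Φ : X → H} (hΦ : Continuous Φ) :
    (ofFeature Φ).IsContinuous :=
  (hΦ.comp continuous_fst).inner (hΦ.comp continuous_snd)

end OfFeature

section MMD

variable {X : Type*} [MeasurableSpace X]

theorem mmd_probToSigned (k : PDKernel X) (P Q : ProbabilityMeasure X) :
    k.mmd (probToSigned P) (probToSigned Q) =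
      ‖∫ x, k.feature x ∂(P : Measure X) - ∫ x, k.feature x ∂(Q : Measure X)‖ := by
  rw [mmd, probToSigned, probToSigned, kme_toSignedMeasure, kme_toSignedMeasure]

theorem posPart_absolutelyContinuous_variation (μ : SignedMeasure X) :
    μ.toJordanDecomposition.posPart ≪ μ.variation := by
  rw [← SignedMeasure.totalVariation_eq_variation]
  exact Measure.absolutelyContinuous_of_le (Measure.le_add_right le_rfl)

theorem negPart_absolutelyContinuous_variation (μ : SignedMeasure X) :
    μ.toJordanDecomposition.negPart ≪ μ.variation := by
  rw [← SignedMeasure.totalVariation_eq_variation]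
  exact Measure.absolutelyContinuous_of_le (Measure.le_add_left le_rfl)

theorem kme_eq_sub {k : PDKernel X} {μ : SignedMeasure X}
    (hp : Integrable k.feature μ.toJordanDecomposition.posPart)
    (hn : Integrable k.feature μ.toJordanDecomposition.negPart) :
    k.kme μ = ∫ x, k.feature x ∂μ.toJordanDecomposition.posPart -
      ∫ x, k.feature x ∂μ.toJordanDecomposition.negPart := by
  conv_lhs => rw [← SignedMeasure.toSignedMeasure_toJordanDecomposition μ]
  rw [kme, JordanDecomposition.toSignedMeasure, VectorMeasure.integral_sub_vectorMeasure,
    VectorMeasure.integral_toSignedMeasure, VectorMeasure.integral_toSignedMeasure]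
  · rwa [VectorMeasure.Integrable, Measure.variation_toSignedMeasure]
  · rwa [VectorMeasure.Integrable, Measure.variation_toSignedMeasure]

variable [TopologicalSpace X]

theorem probToSigned_mem_regularSignedMeasures {P : ProbabilityMeasure X}
    (hP : P ∈ regularProbabilityMeasures X) : probToSigned P ∈ regularSignedMeasures X := by
  rw [regularSignedMeasures, mem_ofPred_eq, probToSigned, Measure.variation_toSignedMeasure]
  exact hP

theorem IsISPD.isCharacteristic {k : PDKernel X} (hk : k.IsISPD) : k.IsCharacteristic := by
  rintro _ ⟨P, hP, rfl⟩ _ ⟨Q, hQ, rfl⟩ h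
  refine hk _ (probToSigned_mem_regularSignedMeasures hP) _
    (probToSigned_mem_regularSignedMeasures hQ) ?_
  rw [mmd, h, sub_self, norm_zero]

variable [BorelSpace X]
variable {H : Type*} [NormedAddCommGroup H] [InnerProductSpace ℝ H] [CompleteSpace H]

/-- Allows all later computations to take place in the concrete space H instead of the RKHS. -/
theorem norm_integral_feature_ofFeature {Φ : X → H} (hΦ : Continuous Φ) {C : ℝ}
    (hC : ∀ x, ‖Φ x‖ ≤ C) {μ ν : Measure X} [IsFiniteMeasure μ] [IsFiniteMeasure ν]
    (hμ : HasSigmaCompactCarrier μ) (hν : HasSigmaCompactCarrier ν) :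
    ‖∫ x, (ofFeature Φ).feature x ∂μ - ∫ x, (ofFeature Φ).feature x ∂ν‖ =
      ‖∫ x, Φ x ∂μ - ∫ x, Φ x ∂ν‖ := by
  obtain ⟨D, hD⟩ := (isBounded_ofFeature hC).exists_norm_feature_le
  have hc := (isContinuous_ofFeature hΦ).continuous_feature
  exact norm_integral_sub_integral_eq_of_inner_eq (fun x y => inner_feature_feature _ x y)
    (hμ.integrable hc hD) (hν.integrable hc hD) (hμ.integrable hΦ hC) (hν.integrable hΦ hC)

variable [T2Space X]

theorem mmd_ofFeature_probToSigned {Φ : X → H} (hΦ : Continuous Φ) {C : ℝ}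
    (hC : ∀ x, ‖Φ x‖ ≤ C) {P Q : ProbabilityMeasure X} (hP : P ∈ regularProbabilityMeasures X)
    (hQ : Q ∈ regularProbabilityMeasures X) :
    (ofFeature Φ).mmd (probToSigned P) (probToSigned Q) =
      ‖∫ x, Φ x ∂(P : Measure X) - ∫ x, Φ x ∂(Q : Measure X)‖ := by
  rw [mmd_probToSigned, norm_integral_feature_ofFeature hΦ hC
    (Measure.Regular.hasSigmaCompactCarrier hP) (Measure.Regular.hasSigmaCompactCarrier hQ)]

theorem hasSigmaCompactCarrier_variation {μ : SignedMeasure X} (hμ : μ ∈ regularSignedMeasures X) :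
    HasSigmaCompactCarrier μ.variation := by
  have : IsFiniteMeasure μ.variation := by
    rw [← SignedMeasure.totalVariation_eq_variation]
    unfold SignedMeasure.totalVariation
    infer_instance
  exact Measure.Regular.hasSigmaCompactCarrier hμ

/-- A kernel is integrally strictly positive definite if its feature map separates finite
measures carried by countable unions of compact sets. -/
theorem isISPD_ofFeature {Φ : X → H} (hΦ : Continuous Φ) {C : ℝ} (hC : ∀ x, ‖Φ x‖ ≤ C)
    (h : ∀ (μ ν : Measure X) [IsFiniteMeasure μ] [IsFiniteMeasure ν], HasSigmaCompactCarrier μ →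
      HasSigmaCompactCarrier ν → ∫ x, Φ x ∂μ = ∫ x, Φ x ∂ν → μ = ν) :
    (ofFeature Φ).IsISPD := by
  intro μ hμ ν hν hd
  obtain ⟨D, hD⟩ := (isBounded_ofFeature hC).exists_norm_feature_le
  have hc := (isContinuous_ofFeature hΦ).continuous_feature
  have hμp := (hasSigmaCompactCarrier_variation hμ).mono_ac (posPart_absolutelyContinuous_variation μ)
  have hμn := (hasSigmaCompactCarrier_variation hμ).mono_ac (negPart_absolutelyContinuous_variation μ)
  have hνp := (hasSigmaCompactCarrier_variation hν).mono_ac (posPart_absolutelyContinuous_variation ν)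
  have hνn := (hasSigmaCompactCarrier_variation hν).mono_ac (negPart_absolutelyContinuous_variation ν)
  -- The identity μ = ν is rearranged as μ⁺ + ν⁻ = ν⁺ + μ⁻, so that only positive measures have to
  -- be separated.
  have key : μ.toJordanDecomposition.posPart + ν.toJordanDecomposition.negPart =
      ν.toJordanDecomposition.posPart + μ.toJordanDecomposition.negPart := by
    refine h _ _ (hμp.add hνn) (hνp.add hμn) (sub_eq_zero.1 (norm_eq_zero.1 ?_))
    rw [← norm_integral_feature_ofFeature hΦ hC (hμp.add hνn) (hνp.add hμn),
      integral_add_measure (hμp.integrable hc hD) (hνn.integrable hc hD),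
      integral_add_measure (hνp.integrable hc hD) (hμn.integrable hc hD)]
    rw [mmd, kme_eq_sub (hμp.integrable hc hD) (hμn.integrable hc hD),
      kme_eq_sub (hνp.integrable hc hD) (hνn.integrable hc hD)] at hd
    rw [← hd]
    congr 1
    abel
  have key' := Measure.toSignedMeasure_congr key
  rw [Measure.toSignedMeasure_add, Measure.toSignedMeasure_add] at key'
  rw [← SignedMeasure.toSignedMeasure_toJordanDecomposition μ,
    ← SignedMeasure.toSignedMeasure_toJordanDecomposition ν, JordanDecomposition.toSignedMeasure,
    JordanDecomposition.toSignedMeasure, sub_eq_sub_iff_add_eq_add, key']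

end MMD

end PDKernel

/-! ### Feature maps that approximate compactly supported functions. -/

section Approximation

section

variable {X : Type*} [MeasurableSpace X]
variable {H : Type*} [NormedAddCommGroup H] [InnerProductSpace ℝ H] [CompleteSpace H]

theorem abs_integral_sub_inner_integral_le {μ : Measure X} [IsFiniteMeasure μ] {Φ : X → H}
    (hΦ : Integrable Φ μ) {g : X → ℝ} (hg : Integrable g μ) {v : H} {ε : ℝ}
    (h : ∀ x, |g x - inner ℝ v (Φ x)| ≤ ε) :
    |∫ x, g x ∂μ - inner ℝ v (∫ x, Φ x ∂μ)| ≤ ε * μ.real univ := by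
  rw [← integral_inner hΦ, ← integral_sub hg (hΦ.const_inner v)]
  exact norm_integral_le_of_norm_le_const (f := fun x => g x - inner ℝ v (Φ x))
    (Eventually.of_forall h)

end

variable {X : Type*} [TopologicalSpace X]
variable {H : Type*} [NormedAddCommGroup H] [InnerProductSpace ℝ H]

/-- The functions `⟪v, Φ ·⟫` approximate uniformly every continuous function with compact
support. -/
def ApproximatesCompactlySupported (Φ : X → H) : Prop :=
  ∀ g : X → ℝ, Continuous g → HasCompactSupport g → ∀ ε > 0,
    ∃ v : H, ∀ x, |g x - inner ℝ v (Φ x)| ≤ ε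

variable [MeasurableSpace X] [BorelSpace X] [CompleteSpace H]

/-- Replacing g by ⟪v, Φ ·⟫ costs at most the uniform error times the mass, and the bound M makes
this cost uniform in n. -/
theorem ApproximatesCompactlySupported.tendsto_integral {Φ : X → H}
    (hΦ : ApproximatesCompactlySupported Φ) {μ : ℕ → Measure X} {ν : Measure X}
    [∀ n, IsFiniteMeasure (μ n)] [IsFiniteMeasure ν] {M : ℝ} (hμM : ∀ n, (μ n).real univ ≤ M)
    (hνM : ν.real univ ≤ M) (hΦμ : ∀ n, Integrable Φ (μ n)) (hΦν : Integrable Φ ν)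
    (h : Tendsto (fun n => ∫ x, Φ x ∂(μ n)) atTop (𝓝 (∫ x, Φ x ∂ν))) {g : X → ℝ}
    (hg : Continuous g) (hgc : HasCompactSupport g) :
    Tendsto (fun n => ∫ x, g x ∂(μ n)) atTop (𝓝 (∫ x, g x ∂ν)) := by
  have hM : 0 ≤ M := measureReal_nonneg.trans hνM
  rw [Metric.tendsto_atTop]
  intro ε hε
  -- The summand 1 covers M = 0; each of the two replacements then costs less than ε/3.
  obtain ⟨v, hv⟩ := hΦ g hg hgc (ε / (3 * (M + 1))) (by positivity)
  have hlim : Tendsto (fun n => (inner ℝ v (∫ x, Φ x ∂(μ n)) : ℝ)) atTop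
      (𝓝 (inner ℝ v (∫ x, Φ x ∂ν))) := tendsto_const_nhds.inner h
  obtain ⟨N, hN⟩ := Metric.tendsto_atTop.1 hlim (ε / 3) (by positivity)
  refine ⟨N, fun n hn => ?_⟩
  have key : ε / (3 * (M + 1)) * M < ε / 3 := by
    rw [div_mul_eq_mul_div, div_lt_div_iff₀ (by positivity) (by positivity)]
    nlinarith
  have h1 := abs_integral_sub_inner_integral_le (hΦμ n) (hg.integrable_of_hasCompactSupport hgc) hv
  have h2 := abs_integral_sub_inner_integral_le hΦν (hg.integrable_of_hasCompactSupport hgc) hv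
  have h1' := h1.trans (mul_le_mul_of_nonneg_left (hμM n) (by positivity))
  have h2' := h2.trans (mul_le_mul_of_nonneg_left hνM (by positivity))
  have h3 := hN n hn
  rw [Real.dist_eq, abs_lt] at *
  rw [abs_le] at h1' h2'
  constructor <;> linarith [h1'.1, h1'.2, h2'.1, h2'.2, h3.1, h3.2]

theorem ApproximatesCompactlySupported.integral_eq {Φ : X → H}
    (hΦ : ApproximatesCompactlySupported Φ) {μ ν : Measure X}
    [IsFiniteMeasure μ] [IsFiniteMeasure ν] (hΦμ : Integrable Φ μ) (hΦν : Integrable Φ ν)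
    (h : ∫ x, Φ x ∂μ = ∫ x, Φ x ∂ν) {g : X → ℝ}
    (hg : Continuous g) (hgc : HasCompactSupport g) : ∫ x, g x ∂μ = ∫ x, g x ∂ν :=
  tendsto_nhds_unique tendsto_const_nhds (hΦ.tendsto_integral (μ := fun _ => μ)
    (fun _ => le_max_left _ _) (le_max_right _ _) (fun _ => hΦμ) hΦν
    (by rw [h]; exact tendsto_const_nhds) hg hgc)

end Approximation

/-! ### From compactly supported to bounded continuous test functions. -/

section CompactSupport

variable {X : Type*} [TopologicalSpace X] [T2Space X] [LocallyCompactSpace X] [MeasurableSpace X]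
  [BorelSpace X]

/-- Finite measures carried by countable unions of compact sets are determined by the integrals
of continuous functions with compact support. -/
theorem ext_of_forall_integral_eq_of_hasCompactSupport [HasOuterApproxClosed X] {μ ν : Measure X}
    [IsFiniteMeasure μ] [IsFiniteMeasure ν] (hμ : HasSigmaCompactCarrier μ)
    (hν : HasSigmaCompactCarrier ν)
    (h : ∀ g : X → ℝ, Continuous g → HasCompactSupport g → ∫ x, g x ∂μ = ∫ x, g x ∂ν) :
    μ = ν := by
  obtain ⟨K, hK, hKm⟩ := hμ.add hν
  rw [ae_add_measure_iff] at hKm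
  -- Cut-offs equal to 1 on K 0 ∪ ... ∪ K n. They tend to 1 almost everywhere for both measures, so
  -- f is reached from f * χ n by dominated convergence.
  have hχ (n : ℕ) := exists_continuous_one_zero_of_isCompact
    ((finite_Iic n).isCompact_biUnion fun i _ => hK i) isClosed_empty (disjoint_empty _)
  choose χ h1 _ hc h01 using hχ
  refine ext_of_forall_integral_eq_of_IsFiniteMeasure fun f => ?_
  have key {m : Measure X} [IsFiniteMeasure m] (hm : ∀ᵐ x ∂m, x ∈ ⋃ n, K n) :
      Tendsto (fun n => ∫ x, f x * χ n x ∂m) atTop (𝓝 (∫ x, f x ∂m)) := by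
    refine tendsto_integral_of_dominated_convergence (fun _ => ‖f‖) (fun n =>
      (f.continuous.mul (χ n).continuous).aestronglyMeasurable) (integrable_const _)
      (fun n => Eventually.of_forall fun x => ?_) ?_
    · rw [norm_mul]
      refine (mul_le_of_le_one_right (norm_nonneg _) ?_).trans (f.norm_coe_le_norm x)
      rw [Real.norm_of_nonneg (h01 n x).1]
      exact (h01 n x).2
    · filter_upwards [hm] with x hx
      obtain ⟨i, hi⟩ := mem_iUnion.1 hx
      refine tendsto_const_nhds.congr' ?_
      filter_upwards [eventually_ge_atTop i] with n hn
      rw [h1 n (mem_biUnion (mem_Iic.2 hn) hi)]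
      simp
  refine tendsto_nhds_unique (key hKm.1) ((key hKm.2).congr fun n => (h _ ?_ ?_).symm)
  · exact f.continuous.mul (χ n).continuous
  · exact (hc n).mul_left

/-- Vague convergence of probability measures to a regular probability measure implies weak
convergence. -/
theorem tendsto_probabilityMeasure_of_hasCompactSupport {P : ℕ → ProbabilityMeasure X}
    {Q : ProbabilityMeasure X} (hQ : Q ∈ regularProbabilityMeasures X)
    (h : ∀ g : X → ℝ, Continuous g → HasCompactSupport g →
      Tendsto (fun n => ∫ x, g x ∂(P n : Measure X)) atTop (𝓝 (∫ x, g x ∂(Q : Measure X)))) :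
    Tendsto P atTop (𝓝 Q) := by
  rw [ProbabilityMeasure.tendsto_iff_forall_integral_tendsto]
  intro f
  rw [Metric.tendsto_atTop]
  intro ε hε
  have hQ' : (Q : Measure X).Regular := hQ
  set M := ‖f‖ + 1 with hM
  have hM0 : 0 < M := by positivity
  set δ := ε / (4 * M) with hδ
  have hδ0 : 0 < δ := by positivity
  obtain ⟨K, -, hK, hQK⟩ := MeasurableSet.univ.exists_isCompact_sdiff_lt (μ := (Q : Measure X))
    (measure_ne_top _ _) (ENNReal.ofReal_pos.2 hδ0).ne'
  obtain ⟨χ, h1, -, hc, h01⟩ := exists_continuous_one_zero_of_isCompact hK isClosed_empty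
    (disjoint_empty K)
  -- Tightness comes from the limit alone: Q has mass at least 1 - δ under χ, and since χ is itself
  -- a test function, P n eventually has mass at least 1 - 2δ there.
  have hχQ : 1 - δ ≤ ∫ x, χ x ∂(Q : Measure X) := by
    have e1 : (Q : Measure X).real K ≤ ∫ x, χ x ∂(Q : Measure X) := by
      rw [← integral_indicator_one hK.measurableSet]
      refine integral_mono ((integrable_const (1 : ℝ)).indicator hK.measurableSet)
        (χ.continuous.integrable_of_hasCompactSupport hc) fun x => ?_
      by_cases hx : x ∈ K
      · simp [hx, h1 hx]
      · simpa [hx] using (h01 x).1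
    have e2 : (Q : Measure X).real Kᶜ ≤ δ := by
      rw [compl_eq_univ_sdiff]
      exact ENNReal.toReal_le_of_le_ofReal hδ0.le hQK.le
    rw [probReal_compl_eq_one_sub hK.measurableSet] at e2
    linarith
  have split (R : ProbabilityMeasure X) : |∫ x, f x ∂(R : Measure X) -
      ∫ x, f x * χ x ∂(R : Measure X)| ≤ M * (1 - ∫ x, χ x ∂(R : Measure X)) := by
    have i1 : Integrable f (R : Measure X) := f.integrable _
    have i2 : Integrable χ (R : Measure X) := χ.continuous.integrable_of_hasCompactSupport hc
    have i3 : Integrable (fun x => f x * χ x) (R : Measure X) :=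
      (f.continuous.mul χ.continuous).integrable_of_hasCompactSupport hc.mul_left
    rw [← integral_sub i1 i3]
    have e : M * (1 - ∫ x, χ x ∂(R : Measure X)) = ∫ x, M * (1 - χ x) ∂(R : Measure X) := by
      rw [integral_const_mul, integral_sub (integrable_const _) i2]
      simp
    rw [e]
    refine norm_integral_le_of_norm_le (f := fun x => f x - f x * χ x) (((integrable_const _).sub i2).const_mul _)
      (Eventually.of_forall fun x => ?_)
    rw [← mul_one_sub, norm_mul, Real.norm_of_nonneg (sub_nonneg.2 (h01 x).2)]
    exact mul_le_mul_of_nonneg_right ((f.norm_coe_le_norm x).trans (by linarith))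
      (sub_nonneg.2 (h01 x).2)
  -- With M * δ = ε/4, truncation costs ε/2 for P n and ε/4 for Q; the truncated integrals account
  -- for the last ε/4.
  obtain ⟨N₁, hN₁⟩ := Metric.tendsto_atTop.1 (h χ χ.continuous hc) δ hδ0
  obtain ⟨N₂, hN₂⟩ := Metric.tendsto_atTop.1 (h _ (f.continuous.mul χ.continuous) hc.mul_left)
    (ε / 4) (by positivity)
  refine ⟨max N₁ N₂, fun n hn => ?_⟩
  have a1 := hN₁ n (le_of_max_le_left hn)
  have a2 := hN₂ n (le_of_max_le_right hn)
  have a3 := split (P n)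
  have a4 := split Q
  have hMδ : M * δ = ε / 4 := by
    rw [hδ]
    field_simp
  rw [Real.dist_eq, abs_lt] at *
  have a3' := a3.trans (mul_le_mul_of_nonneg_left
    (show 1 - ∫ x, χ x ∂(P n : Measure X) ≤ 2 * δ by linarith [a1.1]) hM0.le)
  have a4' := a4.trans (mul_le_mul_of_nonneg_left
    (show 1 - ∫ x, χ x ∂(Q : Measure X) ≤ δ by linarith) hM0.le)
  have hMδ2 : M * (2 * δ) = ε / 2 := by linarith
  rw [hMδ2, abs_le] at a3'
  rw [hMδ, abs_le] at a4'
  simp only [Pi.mul_apply] at a2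
  constructor <;> linarith [a2.1, a2.2, a3'.1, a3'.2, a4'.1, a4'.2]

end CompactSupport

/-! ### Weak convergence implies norm convergence of Hilbert space valued integrals. -/

section WeakConvergence

variable {X : Type*} [MeasurableSpace X]
variable {H : Type*} [NormedAddCommGroup H] [InnerProductSpace ℝ H]

/-- An integrable function with values in a Hilbert space is close in mean to its projection on
some finite-dimensional subspace. -/
theorem exists_finiteDimensional_integral_norm_sub_starProjection_le {μ : Measure X} {Φ : X → H}
    (hΦ : Integrable Φ μ) {ε : ℝ} (hε : 0 < ε) :
    ∃ (V : Submodule ℝ H) (_ : FiniteDimensional ℝ V),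
      ∫ x, ‖Φ x - V.starProjection (Φ x)‖ ∂μ ≤ ε := by
  obtain ⟨s, hs, hsi⟩ := (memLp_one_iff_integrable.2 hΦ).exists_simpleFunc_eLpNorm_sub_lt
    ENNReal.one_ne_top (ENNReal.ofReal_pos.2 hε).ne'
  -- Take the span of the values of an L¹-close simple function s. The projection is the nearest
  -- point of the span, so its error is pointwise at most ‖Φ x - s x‖.
  have : FiniteDimensional ℝ (Submodule.span ℝ (range s)) :=
    FiniteDimensional.span_of_finite ℝ s.finite_range
  refine ⟨Submodule.span ℝ (range s), this, ?_⟩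
  have hd : Integrable (Φ - ⇑s) μ := hΦ.sub (memLp_one_iff_integrable.1 hsi)
  have hle : ∫ x, ‖Φ x - s x‖ ∂μ ≤ ε := by
    have e := integral_norm_eq_lintegral_enorm hd.aestronglyMeasurable
    simp only [Pi.sub_apply] at e
    rw [e]
    rw [eLpNorm_one_eq_lintegral_enorm] at hs
    exact ENNReal.toReal_le_of_le_ofReal hε.le hs.le
  refine (integral_mono ?_ hd.norm fun x => ?_).trans hle
  · exact (hΦ.sub ((Submodule.starProjection (Submodule.span ℝ (range s))).integrable_comp
      hΦ)).norm
  · simp only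
    rw [Submodule.starProjection_minimal]
    exact ciInf_le ⟨0, by rintro _ ⟨y, rfl⟩; exact norm_nonneg _⟩
      (⟨s x, Submodule.subset_span (mem_range_self x)⟩ : Submodule.span ℝ (range s))

/-- In finite dimension weak and norm convergence agree, as seen on the coordinates in an
orthonormal basis. -/
theorem tendsto_starProjection_of_forall_tendsto_inner {V : Submodule ℝ H}
    [FiniteDimensional ℝ V] {y : ℕ → H} {z : H}
    (h : ∀ v, Tendsto (fun n => (inner ℝ v (y n) : ℝ)) atTop (𝓝 (inner ℝ v z))) :
    Tendsto (fun n => V.starProjection (y n)) atTop (𝓝 (V.starProjection z)) := by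
  simp_rw [Submodule.starProjection_apply,
    (stdOrthonormalBasis ℝ V).orthogonalProjectionOnto_apply_eq_sum, Submodule.coe_sum,
    Submodule.coe_smul]
  exact tendsto_finsetSum _ fun i _ => (h _).smul_const _

variable [TopologicalSpace X] [T2Space X] [BorelSpace X] [CompleteSpace H]

/-- Weak convergence of regular probability measures implies the norm convergence of the
integrals of bounded continuous functions with values in a Hilbert space. -/
theorem tendsto_integral_of_tendsto_probabilityMeasure {Φ : X → H} (hΦ : Continuous Φ) {C : ℝ}
    (hC : ∀ x, ‖Φ x‖ ≤ C) {P : ℕ → ProbabilityMeasure X} {Q : ProbabilityMeasure X}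
    (hP : ∀ n, P n ∈ regularProbabilityMeasures X) (hQ : Q ∈ regularProbabilityMeasures X)
    (h : Tendsto P atTop (𝓝 Q)) :
    Tendsto (fun n => ∫ x, Φ x ∂(P n : Measure X)) atTop (𝓝 (∫ x, Φ x ∂(Q : Measure X))) := by
  rw [ProbabilityMeasure.tendsto_iff_forall_integral_tendsto] at h
  have hint {R : ProbabilityMeasure X} (hR : R ∈ regularProbabilityMeasures X) :
      Integrable Φ (R : Measure X) :=
    (Measure.Regular.hasSigmaCompactCarrier hR).integrable hΦ hC
  have hweak (v : H) : Tendsto (fun n => (inner ℝ v (∫ x, Φ x ∂(P n : Measure X)) : ℝ)) atTop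
      (𝓝 (inner ℝ v (∫ x, Φ x ∂(Q : Measure X)))) := by
    have := h (BoundedContinuousFunction.ofNormedAddCommGroup (fun x => inner ℝ v (Φ x))
      (continuous_const.inner hΦ) (‖v‖ * C) fun x => (norm_inner_le_norm _ _).trans
        (mul_le_mul_of_nonneg_left (hC x) (norm_nonneg _)))
    simp only [BoundedContinuousFunction.coe_ofNormedAddCommGroup] at this
    rw [integral_inner (hint hQ)] at this
    exact this.congr fun n => integral_inner (hint (hP n)) v
  rw [Metric.tendsto_atTop]
  intro ε hε
  obtain ⟨V, _, hV⟩ := exists_finiteDimensional_integral_norm_sub_starProjection_le (hint hQ)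
    (ε := ε / 5) (by positivity)
  have hproj : ∀ x, ‖Φ x - V.starProjection (Φ x)‖ ≤ 2 * C := fun x => by
    have := V.norm_starProjection_apply_le (Φ x)
    linarith [norm_sub_le (Φ x) (V.starProjection (Φ x)), hC x]
  -- The projection error is itself a bounded continuous test function. Its smallness under Q thus
  -- passes to P n: at most ε/5 for Q and less than 2ε/5 for P n eventually, with another ε/5 for
  -- the projected integrals.
  have herr := h (BoundedContinuousFunction.ofNormedAddCommGroup
    (fun x => ‖Φ x - V.starProjection (Φ x)‖)
    (hΦ.sub (V.starProjection.continuous.comp hΦ)).norm (2 * C) fun x => by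
      rw [norm_norm]; exact hproj x)
  simp only [BoundedContinuousFunction.coe_ofNormedAddCommGroup] at herr
  obtain ⟨N₁, hN₁⟩ := Metric.tendsto_atTop.1 herr (ε / 5) (by positivity)
  obtain ⟨N₂, hN₂⟩ := Metric.tendsto_atTop.1
    (tendsto_starProjection_of_forall_tendsto_inner (V := V) hweak) (ε / 5) (by positivity)
  have hsplit {R : ProbabilityMeasure X} (hR : R ∈ regularProbabilityMeasures X) :
      dist (∫ x, Φ x ∂(R : Measure X)) (V.starProjection (∫ x, Φ x ∂(R : Measure X))) ≤
        ∫ x, ‖Φ x - V.starProjection (Φ x)‖ ∂(R : Measure X) := by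
    rw [dist_eq_norm, ← ContinuousLinearMap.integral_comp_comm _ (hint hR),
      ← integral_sub (hint hR) (V.starProjection.integrable_comp (hint hR))]
    exact norm_integral_le_integral_norm _
  refine ⟨max N₁ N₂, fun n hn => ?_⟩
  have a1 := hN₁ n (le_of_max_le_left hn)
  have a2 := hN₂ n (le_of_max_le_right hn)
  have a3 := hsplit (hP n)
  have a4 := hsplit hQ
  rw [Real.dist_eq, abs_lt] at a1
  have t1 := dist_triangle4_right (∫ x, Φ x ∂(P n : Measure X)) (∫ x, Φ x ∂(Q : Measure X))
    (V.starProjection (∫ x, Φ x ∂(P n : Measure X))) (V.starProjection (∫ x, Φ x ∂(Q : Measure X)))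
  linarith [a1.2]

end WeakConvergence

/-! ### The feature map built from partitions of unity. -/

section Construction

namespace PartitionOfUnity

theorem norm_finsum_smul_le {ι X E : Type*} [TopologicalSpace X] [NormedAddCommGroup E]
    [NormedSpace ℝ E] (ρ : PartitionOfUnity ι X) {e : ι → E} {C : ℝ} (he : ∀ i, ‖e i‖ ≤ C)
    (x : X) : ‖∑ᶠ i, ρ i x • e i‖ ≤ C := by
  rw [← ρ.sum_finsupport_smul_eq_finsum (fun i _ => e i)]
  calc ‖∑ i ∈ ρ.finsupport x, ρ i x • e i‖ ≤ ∑ i ∈ ρ.finsupport x, ρ i x * C := by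
        refine norm_sum_le_of_le _ fun i _ => ?_
        rw [norm_smul, Real.norm_of_nonneg (ρ.nonneg i x)]
        exact mul_le_mul_of_nonneg_left (he i) (ρ.nonneg i x)
    _ = C := by rw [← Finset.sum_mul, ρ.sum_finsupport (mem_univ x), one_mul]

/-- A compactly supported function that varies by at most `ε` on the sets of a cover is
approximated up to `ε` by a finite combination of the functions of a subordinate partition of
unity. -/
theorem exists_finset_abs_sub_sum_le {ι X : Type*} [TopologicalSpace X]
    (ρ : PartitionOfUnity ι X) {g : X → ℝ} (hgc : HasCompactSupport g) {c : ι → X} {ε : ℝ}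
    (h : ∀ i x, ρ i x ≠ 0 → |g x - g (c i)| ≤ ε) :
    ∃ F : Finset ι, ∀ x, |g x - ∑ i ∈ F, g (c i) * ρ i x| ≤ ε := by
  -- F consists of the indices whose function meets the compact support of g, finitely many by local
  -- finiteness. Where g x ≠ 0 it contains every active index; where g x = 0 the sum over F may be
  -- incomplete, but `h2` still suffices.
  have hF := ρ.locallyFinite.finite_nonempty_inter_compact hgc
  refine ⟨hF.toFinset, fun x => ?_⟩
  classical
  have hsub (i : ι) (hi : ρ i x ≠ 0) (hx : g x ≠ 0) : i ∈ hF.toFinset := by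
    rw [Set.Finite.mem_toFinset]
    exact ⟨x, hi, subset_tsupport g hx⟩
  have h1 : g x = ∑ i ∈ hF.toFinset, g x * ρ i x := by
    by_cases hx : g x = 0
    · simp [hx]
    · rw [← Finset.mul_sum, ρ.sum_finsupport' (mem_univ x), mul_one]
      exact fun i hi => hsub i ((ρ.mem_finsupport x).1 hi) hx
  have hε : 0 ≤ ε := by
    obtain ⟨i, hi⟩ := ρ.exists_pos (mem_univ x)
    exact (abs_nonneg _).trans (h i x hi.ne')
  have h2 : ∑ i ∈ hF.toFinset, ρ i x ≤ 1 := by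
    rw [← ρ.sum_finsupport' (mem_univ x) (Finset.subset_union_right (s₁ := hF.toFinset))]
    exact Finset.sum_le_sum_of_subset_of_nonneg Finset.subset_union_left
      fun i _ _ => ρ.nonneg i x
  calc |g x - ∑ i ∈ hF.toFinset, g (c i) * ρ i x|
      = |∑ i ∈ hF.toFinset, (g x - g (c i)) * ρ i x| := by
        nth_rewrite 1 [h1]
        rw [← Finset.sum_sub_distrib]
        simp only [sub_mul]
    _ ≤ ∑ i ∈ hF.toFinset, ε * ρ i x := by
        refine (Finset.abs_sum_le_sum_abs _ _).trans (Finset.sum_le_sum fun i _ => ?_)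
        rw [abs_mul, abs_of_nonneg (ρ.nonneg i x)]
        by_cases hi : ρ i x = 0
        · simp [hi]
        · exact mul_le_mul_of_nonneg_right (h i x hi) (ρ.nonneg i x)
    _ ≤ ε := by
        rw [← Finset.mul_sum]
        exact mul_le_of_le_one_right hε h2

end PartitionOfUnity

/-- A metric space has a bounded continuous feature map whose coordinates are multiples of the
functions of arbitrarily fine partitions of unity. -/
theorem exists_continuous_approximatesCompactlySupported (X : Type*) [MetricSpace X] :
    ∃ Φ : X → lp (fun _ : ℕ × X => ℝ) 2, Continuous Φ ∧ (∀ x, ‖Φ x‖ ≤ 2) ∧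
      ApproximatesCompactlySupported Φ := by
  classical
  have hρ (n : ℕ) : ∃ ρ : PartitionOfUnity X X,
      ρ.IsSubordinate fun c => Metric.ball c (1 / ((n : ℝ) + 1)) :=
    PartitionOfUnity.exists_isSubordinate isClosed_univ _ (fun _ => Metric.isOpen_ball)
      fun x _ => mem_iUnion.2 ⟨x, Metric.mem_ball_self (by positivity)⟩
  choose ρ hρ using hρ
  -- An orthonormal family indexed by scale and centre. The feature map is the sum over n of 2⁻ⁿ ∑ ρ
  -- n c x • e n c, each inner sum being a convex combination of unit vectors; pairing with e m c
  -- recovers 2⁻ᵐ ρ m c.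
  let e (n : ℕ) (c : X) : lp (fun _ : ℕ × X => ℝ) 2 := lp.single 2 (n, c) 1
  have he (n : ℕ) (c : X) : ‖e n c‖ ≤ 1 := by
    simp [e, lp.norm_single]
  let Ψ (n : ℕ) (x : X) : lp (fun _ : ℕ × X => ℝ) 2 := ∑ᶠ c, ρ n c x • e n c
  have hΨc (n : ℕ) : Continuous (Ψ n) :=
    (ρ n).continuous_finsum_smul fun _ _ _ => continuousAt_const
  have hΨ (n : ℕ) (x : X) : ‖((1 : ℝ) / 2) ^ n • Ψ n x‖ ≤ (1 / 2) ^ n := by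
    rw [norm_smul, norm_pow, Real.norm_of_nonneg (by norm_num)]
    exact mul_le_of_le_one_right (by positivity) ((ρ n).norm_finsum_smul_le (he n) x)
  have hsum (x : X) : Summable fun n => ((1 : ℝ) / 2) ^ n • Ψ n x :=
    Summable.of_norm_bounded summable_geometric_two (fun n => hΨ n x)
  have hee (m n : ℕ) (c d : X) : (inner ℝ (e m c) (e n d) : ℝ) = if n = m ∧ d = c then 1 else 0 := by
    simp only [e, lp.inner_single_left, lp.coeFn_single, Pi.single_apply, Prod.mk.injEq]
    simp [eq_comm]
  have hinner (m : ℕ) (c x : X) :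
      (inner ℝ (e m c) (∑' n, ((1 : ℝ) / 2) ^ n • Ψ n x) : ℝ) = (1 / 2) ^ m * ρ m c x := by
    have h1 (n : ℕ) : (inner ℝ (e m c) (((1 : ℝ) / 2) ^ n • Ψ n x) : ℝ) =
        if n = m then (1 / 2) ^ m * ρ m c x else 0 := by
      simp only [Ψ]
      rw [← (ρ n).sum_finsupport_smul_eq_finsum (fun c _ => e n c), real_inner_smul_right,
        inner_sum]
      simp only [real_inner_smul_right, hee]
      split_ifs with h
      · subst h
        simp only [true_and, mul_ite, mul_one, mul_zero, Finset.sum_ite_eq',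
          PartitionOfUnity.mem_finsupport, Function.mem_support]
        split_ifs with hc
        · rfl
        · rw [not_not.1 hc, mul_zero]
      · simp [h]
    rw [← innerSL_apply_apply ℝ, (innerSL ℝ (e m c)).map_tsum (hsum x)]
    simp only [innerSL_apply_apply, h1, tsum_ite_eq]
  refine ⟨fun x => ∑' n, ((1 : ℝ) / 2) ^ n • Ψ n x,
    continuous_tsum (fun n => (hΨc n).const_smul (((1 : ℝ) / 2) ^ n)) summable_geometric_two hΨ,
    fun x => tsum_of_norm_bounded hasSum_geometric_two fun n => hΨ n x, ?_⟩
  intro g hg hgc ε hε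
  obtain ⟨δ, hδ, hgδ⟩ := Metric.uniformContinuous_iff.1 (hgc.uniformContinuous_of_continuous hg) ε hε
  obtain ⟨n, hn⟩ := exists_nat_one_div_lt hδ
  obtain ⟨F, hF⟩ := (ρ n).exists_finset_abs_sub_sum_le hgc (c := id) (ε := ε) fun c x hx => by
    have : x ∈ Metric.ball c (1 / ((n : ℝ) + 1)) := hρ n c (subset_tsupport _ hx)
    exact (hgδ ((Metric.mem_ball.1 this).trans hn)).le
  -- The factor 2 ^ n undoes the geometric weight of scale n.
  refine ⟨∑ c ∈ F, (g c * 2 ^ n) • e n c, fun x => ?_⟩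
  convert hF x using 3
  rw [sum_inner]
  refine Finset.sum_congr rfl fun c _ => ?_
  rw [real_inner_smul_left, hinner, id, one_div, inv_pow]
  field_simp

end Construction

/-! ### A weight that decays along a sequence without cluster points. -/

section Weight

/-- A noncompact metrizable space contains a sequence without cluster points. -/
theorem exists_seq_forall_not_mapClusterPt (X : Type*) [MetricSpace X] [NoncompactSpace X] :
    ∃ u : ℕ → X, ∀ x, ¬ MapClusterPt x atTop u := by
  by_contra! h
  refine noncompact_univ X (IsSeqCompact.isCompact fun u _ => ?_)
  obtain ⟨x, hx⟩ := h u
  obtain ⟨ψ, hψ, hlim⟩ := hx.tendsto_subseq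
  exact ⟨x, mem_univ x, ψ, hψ, hlim⟩

/-- There is a positive continuous function tending to zero along a sequence without cluster
points. -/
theorem exists_continuous_pos_tendsto_zero {X : Type*} [MetricSpace X] {u : ℕ → X}
    (hu : ∀ x, ¬ MapClusterPt x atTop u) :
    ∃ w : X → ℝ, Continuous w ∧ (∀ x, 0 < w x) ∧ Tendsto (fun n => w (u n)) atTop (𝓝 0) := by
  -- The weight is the distance from (x, 0) to the sequence lifted to height 1/(n+1). It is at most
  -- 1/(n+1) at u n, and a zero at x would make x a cluster point of u: small height forces large n.
  let A : Set (X × ℝ) := range fun n : ℕ => (u n, 1 / ((n : ℝ) + 1))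
  have hA : A.Nonempty := range_nonempty _
  refine ⟨fun x => Metric.infDist (x, (0 : ℝ)) A, by
    exact (Metric.continuous_infDist_pt A).comp (continuous_id.prodMk continuous_const),
    fun x => ?_, ?_⟩
  · refine Metric.infDist_nonneg.lt_of_ne' fun h0 => hu x ?_
    have hx := (Metric.mem_closure_iff_infDist_zero hA).2 h0
    rw [mapClusterPt_iff_frequently]
    intro s hs
    obtain ⟨r, hr, hrs⟩ := Metric.mem_nhds_iff.1 hs
    rw [frequently_atTop]
    intro N
    obtain ⟨_, ⟨n, rfl⟩, hn⟩ := Metric.mem_closure_iff.1 hx (min r (1 / ((N : ℝ) + 1)))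
      (lt_min hr (by positivity))
    rw [Prod.dist_eq, max_lt_iff, lt_min_iff, lt_min_iff] at hn
    refine ⟨n, ?_, hrs (by rw [Metric.mem_ball, dist_comm]; exact hn.1.1)⟩
    have h2 := hn.2.2
    rw [Real.dist_eq, zero_sub, abs_neg, abs_of_pos (by positivity),
      one_div_lt_one_div (by positivity) (by positivity)] at h2
    have h3 : (N : ℝ) < n := by linarith
    exact_mod_cast h3.le
  · refine squeeze_zero (fun _ => Metric.infDist_nonneg) (fun n => ?_)
      tendsto_one_div_add_atTop_nhds_zero_nat
    refine (Metric.infDist_le_dist_of_mem (mem_range_self n)).trans_eq ?_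
    rw [Prod.dist_eq, dist_self, Real.dist_eq, zero_sub, abs_neg, abs_of_pos (by positivity),
      max_eq_right (by positivity)]

end Weight

/-! ### Separation and metrization by approximating feature maps. -/

namespace PDKernel

section Metrizable

variable {X : Type*} [TopologicalSpace X] [T2Space X] [LocallyCompactSpace X] [MeasurableSpace X]
  [BorelSpace X]
variable {H : Type*} [NormedAddCommGroup H] [InnerProductSpace ℝ H] [CompleteSpace H]

theorem eq_of_integral_eq [HasOuterApproxClosed X] {Φ : X → H} (hΦ : Continuous Φ) {C : ℝ}
    (hC : ∀ x, ‖Φ x‖ ≤ C) (hΦa : ApproximatesCompactlySupported Φ) {μ ν : Measure X}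
    [IsFiniteMeasure μ] [IsFiniteMeasure ν] (hμ : HasSigmaCompactCarrier μ)
    (hν : HasSigmaCompactCarrier ν) (h : ∫ x, Φ x ∂μ = ∫ x, Φ x ∂ν) : μ = ν :=
  ext_of_forall_integral_eq_of_hasCompactSupport hμ hν fun _ hg hgc =>
    hΦa.integral_eq (hμ.integrable hΦ hC) (hν.integrable hΦ hC) h hg hgc

/-- Only the MMD between probability measures has to come from Φ, so k may be a kernel with a
different feature map, such as a translate of Φ. -/
theorem metrizesWeakConvergence_of_mmd_eq {Φ : X → H} (hΦ : Continuous Φ) {C : ℝ}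
    (hC : ∀ x, ‖Φ x‖ ≤ C) (hΦa : ApproximatesCompactlySupported Φ) {k : PDKernel X}
    (hk : ∀ P ∈ regularProbabilityMeasures X, ∀ Q ∈ regularProbabilityMeasures X,
      k.mmd (probToSigned P) (probToSigned Q) =
        ‖∫ x, Φ x ∂(P : Measure X) - ∫ x, Φ x ∂(Q : Measure X)‖) :
    k.MetrizesWeakConvergence := by
  intro P Q hP hQ
  have e (n : ℕ) := hk (P n) (hP n) Q hQ
  simp_rw [e, ← tendsto_iff_norm_sub_tendsto_zero]
  have hint {R : ProbabilityMeasure X} (hR : R ∈ regularProbabilityMeasures X) :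
      Integrable Φ (R : Measure X) :=
    (Measure.Regular.hasSigmaCompactCarrier hR).integrable hΦ hC
  refine ⟨fun h => tendsto_probabilityMeasure_of_hasCompactSupport hQ fun g hg hgc => ?_,
    tendsto_integral_of_tendsto_probabilityMeasure hΦ hC hP hQ⟩
  exact hΦa.tendsto_integral (M := 1) (fun n => by simp) (by simp) (fun n => hint (hP n))
    (hint hQ) h hg hgc

end Metrizable

/-! ### Dirac measures and metrizability of the space. -/

section Dirac

variable {X : Type*} [MeasurableSpace X]

theorem probToSigned_ne_zero (P : ProbabilityMeasure X) : probToSigned P ≠ 0 := by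
  intro h
  have h1 : probToSigned P univ = 1 := by
    rw [probToSigned, Measure.toSignedMeasure_apply_measurable MeasurableSet.univ]
    simp
  rw [h] at h1
  simp at h1

variable [TopologicalSpace X]

theorem zero_mem_regularSignedMeasures : (0 : SignedMeasure X) ∈ regularSignedMeasures X := by
  rw [regularSignedMeasures, mem_ofPred_eq, VectorMeasure.variation_zero]
  infer_instance

variable [T2Space X] [BorelSpace X]

theorem diracProba_mem_regularProbabilityMeasures (x : X) :
    diracProba x ∈ regularProbabilityMeasures X :=
  regular_dirac x

theorem kme_probToSigned_diracProba (k : PDKernel X) (x : X) :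
    k.kme (probToSigned (diracProba x)) = k.feature x := by
  rw [probToSigned, kme_toSignedMeasure]
  exact integral_dirac _ x

theorem probToSigned_diracProba_mem (x : X) :
    probToSigned (diracProba x) ∈ regularSignedMeasures X :=
  probToSigned_mem_regularSignedMeasures (diracProba_mem_regularProbabilityMeasures x)

theorem mmd_diracProba (k : PDKernel X) (x y : X) :
    k.mmd (probToSigned (diracProba x)) (probToSigned (diracProba y)) =
      ‖k.feature x - k.feature y‖ := by
  rw [mmd, kme_probToSigned_diracProba, kme_probToSigned_diracProba]

/-- Otherwise the Dirac at x would not be separated from the zero measure. -/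
theorem IsISPD.feature_ne_zero {k : PDKernel X} (hk : k.IsISPD) (x : X) : k.feature x ≠ 0 := by
  intro h
  refine probToSigned_ne_zero (diracProba x) (hk _ (probToSigned_diracProba_mem x) _
    zero_mem_regularSignedMeasures ?_)
  rw [mmd, kme_probToSigned_diracProba, h, kme, VectorMeasure.integral_zero_vectorMeasure,
    sub_zero, norm_zero]

theorem IsISPD.feature_injective {k : PDKernel X} (hk : k.IsISPD) :
    Function.Injective k.feature := by
  intro x y hxy
  have h := hk _ (probToSigned_diracProba_mem x) _ (probToSigned_diracProba_mem y) (by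
    rw [mmd_diracProba, hxy, sub_self, norm_zero])
  have h2 := congrArg (fun m : SignedMeasure X => m {x}) h
  simp only [probToSigned, Measure.toSignedMeasure_apply_measurable (measurableSet_singleton x)]
    at h2
  by_contra hne
  have e1 : ((diracProba x : ProbabilityMeasure X) : Measure X) = Measure.dirac x := rfl
  have e2 : ((diracProba y : ProbabilityMeasure X) : Measure X) = Measure.dirac y := rfl
  rw [e1, e2, measureReal_def, measureReal_def,
    Measure.dirac_apply' x (measurableSet_singleton x),
    Measure.dirac_apply' y (measurableSet_singleton x)] at h2
  simp [Ne.symm hne] at h2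

/-- A space that carries a continuous integrally strictly positive definite kernel whose RKHS
consists of functions vanishing at infinity is metrizable. -/
theorem IsISPD.metrizableSpace_of_hilbSubsetC0 {k : PDKernel X} (hk : k.IsISPD)
    (hc : k.IsContinuous) (h0 : k.HilbSubsetC0) : TopologicalSpace.MetrizableSpace X := by
  refine IsEmbedding.metrizableSpace (f := k.feature)
    ⟨isInducing_iff_nhds.2 fun x => le_antisymm (hc.continuous_feature.tendsto x).le_comap ?_,
      hk.feature_injective⟩
  intro V hV
  -- Since k(·, x) vanishes at infinity and is positive at x, a feature near that of x has its point
  -- in a compact K. The part of K outside the interior of V has compact image missing the feature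
  -- of x, so closer features come from V.
  obtain ⟨g, hg⟩ := h0 (k.feature x)
  have hgx : 0 < g x := by
    rw [hg, ← inner_feature, real_inner_self_eq_norm_sq]
    exact pow_pos (norm_pos_iff.2 (hk.feature_ne_zero x)) 2
  have hsmall : ∀ᶠ y in cocompact X, g y < g x / 2 :=
    g.zero_at_infty'.eventually (gt_mem_nhds (half_pos hgx))
  obtain ⟨K, hK, hKg⟩ := mem_cocompact.1 hsmall
  have hL : IsClosed (k.feature '' (K \ interior V)) :=
    ((hK.diff isOpen_interior).image hc.continuous_feature).isClosed
  have hxL : k.feature x ∉ k.feature '' (K \ interior V) := by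
    rintro ⟨y, hy, hyx⟩
    rw [hk.feature_injective hyx] at hy
    exact hy.2 (mem_interior_iff_mem_nhds.2 hV)
  have hlarge : ∀ᶠ f in 𝓝 (k.feature x), g x / 2 < inner ℝ f (k.feature x) := by
    have hcont : Continuous fun f : k.Hilb => (inner ℝ f (k.feature x) : ℝ) :=
      continuous_id.inner continuous_const
    refine hcont.continuousAt.eventually (lt_mem_nhds ?_)
    simp only
    rw [inner_feature, ← hg]
    linarith
  refine mem_comap.2 ⟨_, inter_mem (hL.isOpen_compl.mem_nhds hxL) hlarge, ?_⟩
  rintro y ⟨hy1, hy2⟩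
  have hyK : y ∈ K := by
    by_contra hyK
    have h1 : g y < g x / 2 := hKg hyK
    have h2 : g x / 2 < inner ℝ (k.feature y) (k.feature x) := hy2
    rw [inner_feature, ← hg] at h2
    linarith
  by_contra hyV
  exact hy1 ⟨y, ⟨hyK, fun h => hyV (interior_subset h)⟩, rfl⟩

variable [LocallyCompactSpace X]

/-- A space that carries a continuous integrally strictly positive definite kernel metrizing weak
convergence is metrizable. -/
theorem IsISPD.metrizableSpace_of_metrizesWeakConvergence {k : PDKernel X} (hk : k.IsISPD)
    (hc : k.IsContinuous) (hm : k.MetrizesWeakConvergence) :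
    TopologicalSpace.MetrizableSpace X := by
  refine IsEmbedding.metrizableSpace (f := k.feature)
    ⟨isInducing_iff_nhds.2 fun x => le_antisymm (hc.continuous_feature.tendsto x).le_comap ?_,
      hk.feature_injective⟩
  -- The filter pulled back from the Hilbert space is countably generated, so sequences suffice;
  -- along them, convergence of features is MMD convergence of Diracs.
  rw [← tendsto_id', tendsto_iff_seq_tendsto]
  intro u hu
  have hu' : Tendsto (fun n => k.feature (u n)) atTop (𝓝 (k.feature x)) :=
    (tendsto_comap_iff (f := u) (g := k.feature)).1 hu
  rw [tendsto_iff_norm_sub_tendsto_zero] at hu'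
  simp_rw [← mmd_diracProba] at hu'
  -- Complete regularity, inherited from the one-point compactification, turns weak convergence of
  -- Diracs into convergence of points.
  have : CompletelyRegularSpace X :=
    OnePoint.isOpenEmbedding_coe.isInducing.completelyRegularSpace
  have h := (hm (fun n => diracProba (u n)) (diracProba x)
    (fun n => diracProba_mem_regularProbabilityMeasures _)
    (diracProba_mem_regularProbabilityMeasures _)).1 hu'
  exact (tendsto_diracProba_iff_tendsto (map u atTop)).1 h

end Dirac

/-! ### The weighted kernel. -/

section Weighted

/-- Finite measures with the same total mass and the same multiple by a weight vanishing only at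
one point are equal. -/
theorem eq_of_withDensity_eq {X : Type*} [MeasurableSpace X]
    [MeasurableSingletonClass X] {w : X → NNReal} (hw : Measurable w) {p : X}
    (hw0 : ∀ x, x ≠ p → w x ≠ 0) {μ ν : Measure X} [IsFiniteMeasure μ] [IsFiniteMeasure ν]
    (huniv : μ univ = ν univ)
    (h : μ.withDensity (fun x => (w x : ENNReal)) = ν.withDensity fun x => (w x : ENNReal)) :
    μ = ν := by
  have hm : MeasurableSet ({p}ᶜ : Set X) := (measurableSet_singleton p).compl
  have hwm : Measurable fun x => (w x : ENNReal) := hw.coe_nnreal_ennreal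
  -- Off p the weight is invertible, so the weighted measure determines the original there; the atom
  -- at p then follows from the total mass.
  have hinv (m : Measure X) : m.restrict {p}ᶜ =
      ((m.withDensity fun x => (w x : ENNReal)).restrict {p}ᶜ).withDensity
        fun x => (w x : ENNReal)⁻¹ := by
    rw [restrict_withDensity hm, withDensity_inv_same hwm]
    · rw [ae_restrict_iff' hm]
      exact Eventually.of_forall fun x hx => ENNReal.coe_ne_zero.2 (hw0 x hx)
    · exact Eventually.of_forall fun x => ENNReal.coe_ne_top
  have hr : μ.restrict {p}ᶜ = ν.restrict {p}ᶜ := by rw [hinv μ, hinv ν, h]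
  have hp : μ {p} = ν {p} := by
    have hc : μ {p}ᶜ = ν {p}ᶜ := by
      rw [← Measure.restrict_apply_univ, hr, Measure.restrict_apply_univ]
    have e1 := measure_add_measure_compl (μ := μ) (measurableSet_singleton p)
    have e2 := measure_add_measure_compl (μ := ν) (measurableSet_singleton p)
    rw [huniv, ← e2, hc] at e1
    exact (ENNReal.add_left_inj (measure_ne_top _ _)).1 e1
  rw [← Measure.restrict_add_restrict_compl (μ := μ) (measurableSet_singleton p),
    ← Measure.restrict_add_restrict_compl (μ := ν) (measurableSet_singleton p), hr,
    Measure.restrict_singleton, Measure.restrict_singleton, hp]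

variable {X : Type*} {H : Type*} [NormedAddCommGroup H] [InnerProductSpace ℝ H]

/-- The feature map of the kernel `1 + w(x) w(y) ⟪Φ x, Φ y⟫`. -/
noncomputable def weightedFeature (w : X → NNReal) (Φ : X → H) (x : X) : WithLp 2 (ℝ × H) :=
  (WithLp.prodContinuousLinearEquiv 2 ℝ ℝ H).symm (1, w x • Φ x)

theorem continuous_weightedFeature [TopologicalSpace X] {w : X → NNReal} (hw : Continuous w) {Φ : X → H}
    (hΦ : Continuous Φ) : Continuous (weightedFeature w Φ) :=
  (WithLp.prodContinuousLinearEquiv 2 ℝ ℝ H).symm.continuous.comp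
    (continuous_const.prodMk (hw.smul hΦ))

/-- Any uniform bound will do; the operator norm accounts for passing from the sup norm on ℝ × H to
the Hilbert norm. -/
theorem norm_weightedFeature_le {w : X → NNReal} (hw1 : ∀ x, w x ≤ 1) {Φ : X → H} {C : ℝ}
    (hC : ∀ x, ‖Φ x‖ ≤ C) (x : X) :
    ‖weightedFeature w Φ x‖ ≤
      ‖((WithLp.prodContinuousLinearEquiv 2 ℝ ℝ H).symm : ℝ × H →L[ℝ] WithLp 2 (ℝ × H))‖ *
        max 1 C := by
  refine (ContinuousLinearMap.le_opNorm
    ((WithLp.prodContinuousLinearEquiv 2 ℝ ℝ H).symm : ℝ × H →L[ℝ] WithLp 2 (ℝ × H)) _).trans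
    (mul_le_mul_of_nonneg_left ?_ (norm_nonneg _))
  rw [Prod.norm_def]
  refine max_le_max (by simp) ?_
  rw [NNReal.smul_def, norm_smul, Real.norm_of_nonneg (w x).coe_nonneg]
  exact (mul_le_of_le_one_left (norm_nonneg _) (by exact_mod_cast hw1 x)).trans (hC x)

theorem norm_feature_ofFeature_weightedFeature_sub {w : X → NNReal} (Φ : X → H) {p : X}
    (hp : w p = 0) (x : X) :
    ‖(ofFeature (weightedFeature w Φ)).feature x - (ofFeature (weightedFeature w Φ)).feature p‖ =
      w x * ‖Φ x‖ := by
  rw [← sq_eq_sq₀ (norm_nonneg _) (by positivity), norm_feature_sub_sq]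
  simp only [ofFeature_apply, weightedFeature, WithLp.prod_inner_apply, hp, NNReal.smul_def,
    WithLp.prodContinuousLinearEquiv_symm_apply, real_inner_self_eq_norm_sq,
    zero_smul, inner_zero_right, norm_one, norm_smul, Real.norm_of_nonneg (w x).coe_nonneg]
  ring

variable [TopologicalSpace X] [T2Space X] [LocallyCompactSpace X] [MeasurableSpace X]
  [BorelSpace X] [CompleteSpace H]

/-- The first component of the embedding is the total mass and the second is the Φ-embedding of the
measure with density w, which determines that measure; `eq_of_withDensity_eq` combines the two. -/
theorem isISPD_ofFeature_weightedFeature [HasOuterApproxClosed X] {w : X → NNReal}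
    (hw : Continuous w) (hw1 : ∀ x, w x ≤ 1) {p : X} (hw0 : ∀ x, x ≠ p → w x ≠ 0) {Φ : X → H}
    (hΦ : Continuous Φ) {C : ℝ} (hC : ∀ x, ‖Φ x‖ ≤ C) (hΦa : ApproximatesCompactlySupported Φ) :
    (ofFeature (weightedFeature w Φ)).IsISPD := by
  have hc := continuous_weightedFeature hw hΦ
  have hb := norm_weightedFeature_le hw1 hC
  refine isISPD_ofFeature hc hb fun μ ν _ _ hμ hν h => ?_
  have hcomp {m : Measure X} [IsFiniteMeasure m] (hm : HasSigmaCompactCarrier m) :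
      (WithLp.prodContinuousLinearEquiv 2 ℝ ℝ H : WithLp 2 (ℝ × H) →L[ℝ] ℝ × H)
        (∫ x, weightedFeature w Φ x ∂m) = (m.real univ, ∫ x, w x • Φ x ∂m) := by
    rw [← ContinuousLinearMap.integral_comp_comm _ (hm.integrable hc hb)]
    have e (x : X) : (WithLp.prodContinuousLinearEquiv 2 ℝ ℝ H : WithLp 2 (ℝ × H) →L[ℝ] ℝ × H)
        (weightedFeature w Φ x) = (1, w x • Φ x) :=
      (WithLp.prodContinuousLinearEquiv 2 ℝ ℝ H).apply_symm_apply _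
    simp_rw [e]
    rw [integral_pair (integrable_const _) (hm.integrable (f := fun x => w x • Φ x) (hw.smul hΦ)
      (C := C) fun x => ?_)]
    · simp
    · rw [NNReal.smul_def, norm_smul, Real.norm_of_nonneg (w x).coe_nonneg]
      exact (mul_le_of_le_one_left (norm_nonneg _) (by exact_mod_cast hw1 x)).trans (hC x)
  have h' := hcomp hμ
  rw [h, hcomp hν, Prod.mk.injEq] at h'
  have hfin (m : Measure X) [IsFiniteMeasure m] :
      IsFiniteMeasure (m.withDensity fun x => (w x : ENNReal)) := by
    refine isFiniteMeasure_withDensity (ne_top_of_le_ne_top (measure_ne_top m univ) ?_)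
    refine (lintegral_mono (g := fun _ => 1) fun x => ?_).trans (by simp)
    exact ENNReal.coe_le_one_iff.2 (hw1 x)
  have := hfin μ
  have := hfin ν
  refine eq_of_withDensity_eq hw.measurable hw0 ?_ (eq_of_integral_eq hΦ hC hΦa
    (hμ.mono_ac (withDensity_absolutelyContinuous _ _))
    (hν.mono_ac (withDensity_absolutelyContinuous _ _)) ?_)
  · exact ((measureReal_eq_measureReal_iff).1 h'.1).symm
  · rw [integral_withDensity_eq_integral_smul hw.measurable,
      integral_withDensity_eq_integral_smul hw.measurable, h'.2]

end Weighted

/-! ### The two examples on a metrizable space. -/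

section Existence

variable (X : Type*) [TopologicalSpace X] [T2Space X] [LocallyCompactSpace X]
  [NoncompactSpace X] [MeasurableSpace X] [BorelSpace X] [TopologicalSpace.MetrizableSpace X]

theorem exists_isISPD_not_metrizesWeakConvergence :
    ∃ k : PDKernel X, k.IsBounded ∧ k.IsContinuous ∧ k.IsISPD ∧ ¬ k.MetrizesWeakConvergence := by
  let _ := TopologicalSpace.metrizableSpaceMetric X
  obtain ⟨Φ, hΦ, hC, hΦa⟩ := exists_continuous_approximatesCompactlySupported X
  obtain ⟨u, hu⟩ := exists_seq_forall_not_mapClusterPt X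
  obtain ⟨v, hv, hv0, hvu⟩ := exists_continuous_pos_tendsto_zero hu
  let p : X := u 0
  -- The factor in v gives decay along u, the distance factor a zero exactly at p, and the
  -- truncations the bound 1.
  let w (x : X) : NNReal := Real.toNNReal (min 1 (v x) * min 1 (dist x p))
  have hw : Continuous w :=
    continuous_real_toNNReal.comp ((continuous_const.min hv).mul
      (continuous_const.min (continuous_id.dist continuous_const)))
  have hwp : w p = 0 := by simp [w]
  have hw1 (x : X) : w x ≤ 1 :=
    Real.toNNReal_le_one.2 (mul_le_one₀ (min_le_left _ _) (le_min zero_le_one dist_nonneg)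
      (min_le_left _ _))
  have hw0 (x : X) (hx : x ≠ p) : w x ≠ 0 :=
    (Real.toNNReal_pos.2 (mul_pos (lt_min one_pos (hv0 x))
      (lt_min one_pos (dist_pos.2 hx)))).ne'
  have hwv (x : X) : (w x : ℝ) ≤ v x := by
    rw [Real.coe_toNNReal _ (mul_nonneg (le_min zero_le_one (hv0 x).le)
      (le_min zero_le_one dist_nonneg))]
    exact (mul_le_of_le_one_right (le_min zero_le_one (hv0 x).le) (min_le_left _ _)).trans
      (min_le_right _ _)
  refine ⟨ofFeature (weightedFeature w Φ), isBounded_ofFeature (norm_weightedFeature_le hw1 hC),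
    isContinuous_ofFeature (continuous_weightedFeature hw hΦ),
    isISPD_ofFeature_weightedFeature hw hw1 hw0 hΦ hC hΦa, fun hm => hu p ?_⟩
  have hlim : Tendsto (fun n => diracProba (u n)) atTop (𝓝 (diracProba p)) := by
    refine (hm _ _ (fun n => diracProba_mem_regularProbabilityMeasures _)
      (diracProba_mem_regularProbabilityMeasures _)).1 ?_
    simp_rw [mmd_diracProba, norm_feature_ofFeature_weightedFeature_sub Φ hwp]
    refine squeeze_zero (fun n => by positivity) (fun n => mul_le_mul (hwv (u n)) (hC (u n))
      (norm_nonneg _) (hv0 _).le) ?_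
    simpa using hvu.mul_const 2
  exact Tendsto.mapClusterPt ((tendsto_diracProba_iff_tendsto (map u atTop)).1 hlim)

/-- Translating Φ by Φ p shifts the embedding of every probability measure by the same vector, so
the MMD between them is unchanged, while the feature of p becomes zero. -/
theorem exists_isCharacteristic_not_isISPD_metrizesWeakConvergence :
    ∃ k : PDKernel X, k.IsBounded ∧ k.IsContinuous ∧ k.IsCharacteristic ∧ ¬ k.IsISPD ∧
      k.MetrizesWeakConvergence := by
  let _ := TopologicalSpace.metrizableSpaceMetric X
  obtain ⟨Φ, hΦ, hC, hΦa⟩ := exists_continuous_approximatesCompactlySupported X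
  obtain ⟨u, -⟩ := exists_seq_forall_not_mapClusterPt X
  let p : X := u 0
  have hΨ : Continuous fun x => Φ x - Φ p := hΦ.sub continuous_const
  have hD (x : X) : ‖Φ x - Φ p‖ ≤ 4 := (norm_sub_le _ _).trans (by linarith [hC x, hC p])
  have hmmd : ∀ P ∈ regularProbabilityMeasures X, ∀ Q ∈ regularProbabilityMeasures X,
      (ofFeature fun x => Φ x - Φ p).mmd (probToSigned P) (probToSigned Q) =
        ‖∫ x, Φ x ∂(P : Measure X) - ∫ x, Φ x ∂(Q : Measure X)‖ := by
    intro P hP Q hQ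
    have hint {R : ProbabilityMeasure X} (hR : R ∈ regularProbabilityMeasures X) :
        ∫ x, (Φ x - Φ p) ∂(R : Measure X) = ∫ x, Φ x ∂(R : Measure X) - Φ p := by
      rw [integral_sub ((Measure.Regular.hasSigmaCompactCarrier hR).integrable hΦ hC)
        (integrable_const _)]
      simp
    rw [mmd_ofFeature_probToSigned hΨ hD hP hQ, hint hP, hint hQ, sub_sub_sub_cancel_right]
  refine ⟨ofFeature fun x => Φ x - Φ p, isBounded_ofFeature hD, isContinuous_ofFeature hΨ, ?_, ?_,
    metrizesWeakConvergence_of_mmd_eq hΦ hC hΦa hmmd⟩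
  · rintro _ ⟨P, hP, rfl⟩ _ ⟨Q, hQ, rfl⟩ h
    have h0 := hmmd P hP Q hQ
    rw [mmd, h, sub_self, norm_zero, eq_comm, norm_eq_zero, sub_eq_zero] at h0
    have hPQ := eq_of_integral_eq hΦ hC hΦa (Measure.Regular.hasSigmaCompactCarrier hP)
      (Measure.Regular.hasSigmaCompactCarrier hQ) h0
    rw [Subtype.ext hPQ]
  · intro h
    refine h.feature_ne_zero p ?_
    rw [← norm_eq_zero, ← sq_eq_zero_iff, ← real_inner_self_eq_norm_sq, inner_feature_feature]
    simp

end Existence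

end PDKernel

theorem mainTheorem5 (X : Type*) [TopologicalSpace X] [T2Space X] [LocallyCompactSpace X]
    [NoncompactSpace X] [MeasurableSpace X] [BorelSpace X] :
    ((TopologicalSpace.MetrizableSpace X ∨
        ∃ k₀ : PDKernel X, k₀.IsBounded ∧ k₀.IsContinuous ∧ k₀.IsISPD) →
      (∃ k : PDKernel X, k.IsBounded ∧ k.IsContinuous ∧ k.HilbSubsetCb ∧
        k.IsISPD ∧ k.IsCharacteristic ∧ ¬ k.MetrizesWeakConvergence) ∧
      ¬ (∀ k : PDKernel X, k.HilbSubsetCb →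
        (k.MetrizesWeakConvergence ↔ k.IsContinuous ∧ k.IsISPD)) ∧
      ¬ (∀ k : PDKernel X, k.IsBounded → k.IsContinuous →
        (k.MetrizesWeakConvergence ↔ k.IsCharacteristic))) ∧
    ((TopologicalSpace.MetrizableSpace X ∨
        ∃ k₀ : PDKernel X, k₀.IsBounded ∧ k₀.IsContinuous ∧ k₀.HilbSubsetC0 ∧ k₀.IsISPD) →
      ∃ k : PDKernel X, k.IsBounded ∧ k.IsContinuous ∧ k.HilbSubsetCb ∧
        k.IsCharacteristic ∧ ¬ k.IsISPD ∧ k.MetrizesWeakConvergence) := by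
  constructor
  · intro h
    obtain ⟨k, hb, hc, hi, hm⟩ : ∃ k : PDKernel X, k.IsBounded ∧ k.IsContinuous ∧ k.IsISPD ∧
        ¬ k.MetrizesWeakConvergence := by
      rcases h with h | ⟨k₀, hb, hc, hi⟩
      · exact PDKernel.exists_isISPD_not_metrizesWeakConvergence X
      -- Either k₀ forces X to be metrizable, or k₀ is already the required example.
      · by_cases hm : k₀.MetrizesWeakConvergence
        · have := hi.metrizableSpace_of_metrizesWeakConvergence hc hm
          exact PDKernel.exists_isISPD_not_metrizesWeakConvergence X
        · exact ⟨k₀, hb, hc, hi, hm⟩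
    have hCb := PDKernel.hilbSubsetCb_of_isBounded_of_isContinuous hb hc
    exact ⟨⟨k, hb, hc, hCb, hi, hi.isCharacteristic, hm⟩,
      fun hall => hm ((hall k hCb).2 ⟨hc, hi⟩), fun hall => hm ((hall k hb hc).2 hi.isCharacteristic)⟩
  · intro h
    have : TopologicalSpace.MetrizableSpace X := by
      rcases h with h | ⟨k₀, -, hc, h0, hi⟩
      · exact h
      · exact hi.metrizableSpace_of_hilbSubsetC0 hc h0
    obtain ⟨k, hb, hc, hch, hi, hm⟩ :=
      PDKernel.exists_isCharacteristic_not_isISPD_metrizesWeakConvergence X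
    exact ⟨k, hb, hc, PDKernel.hilbSubsetCb_of_isBounded_of_isContinuous hb hc, hch, hi, hm⟩
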